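/- Let $K$ be an infinite field, $n\ge 1$, $d\ge 2$, and let $R=K[x_1,\dots,x_n]$ with its standard grading. For $0\le j\le d-1$ let $R^{(d)}=\bigoplus_{i\ge0}R_{di}$ be the $d$-th Veronese algebra (with degree $i$ component $R_{di}$) and let $M_j^{(d)}=\bigoplus_{i\ge0}R_{di+j}$ be the $j$-th Veronese module, a graded $R^{(d)}$-module (with degree $i$ component $R_{di+j}$). *Definitions.* A homogeneous algebra with straightening laws (ASL) over $K$ on a finite poset $P\subset A$ is a graded $K$-algebra $A=\bigoplus_{i\ge0}A_i$ with $A_0=K$, generated by $P\subset A_1$, such that the standard monomials $\gamma_1\cdots\gamma_t$ ($t\ge0$, $\gamma_1\le\dots\le\gamma_t$ in $P$) form a $K$-basis of $A$, and such that, for incomparable $\alpha,\beta\in P$, every standard monomial $\gamma_1\cdots\gamma_t$ occurring with nonzero coefficient in the expansion of $\alpha\beta$ satisfies $t\ge1$, $\gamma_1<\alpha$ and $\gamma_1<\beta$. Given such an $A$, a graded $A$-module $M$ is a homogeneous module with straightening laws (MSL) over $A$ on a finite poset $Q\subset M_0$, with poset ideals (down-closed subsets) $\mathcal I(x)\subset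 P$ for $x\in Q$, if the standard elements $\alpha_1\cdots\alpha_i x$ ($x\in Q$, $i\ge0$, $\alpha_1\le\dots\le\alpha_i$ in $P$, and $\alpha_1\notin\mathcal I(x)$ if $i\ge1$) form a $K$-basis of $M$, and $\alpha x\in\sum_{y\in Q,\,y<x}Ay$ for all $x\in Q$ and $\alpha\in\mathcal I(x)$. For $m\ge0$ let $H_n(m)=\{\alpha\in\{1,\dots,n\}^m:\alpha_1+\dots+\alpha_m\le n+m-1\}$, ordered componentwise (so $H_n(0)$ is a single point). For linear forms $\ell_{ik}\in R_1$ ($1\le i\le n$, $1\le k\le d$) put $f_\alpha=\ell_{\alpha_1 1}\cdots\ell_{\alpha_d d}\in R^{(d)}$ for $\alpha\in H_n(d)$, and, for $0\le j\le d-1$ and $(i_1,\dots,i_j)\in H_n(j)$, put $$g_{i_1\dots i_j}=\ell_{i_1 1}\cdots\ell_{i_j j}\in M_j^{(d)},\qquad \mathcal I(g_{i_1\dots i_j})=\{f_\alpha:\alpha\in H_n(d),\ \alpha\not\ge(i_1,\dots,i_j,1,\dots,1)\}.$$ **Theorem.** 1. For generic linear forms $\ell_{ik}$ (that is, whenever the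 coefficients of the $\ell_{ik}$ do not annihilate a certain nonzero polynomial over $K$, which depends only on $K,n,d$) the following hold: the forms $\ell_{1k_1},\dots,\ell_{nk_n}$ are linearly independent for all $k_1,\dots,k_n\in\{1,\dots,d\}$; $R^{(d)}$ is a homogeneous ASL on the poset $\{f_\alpha:\alpha\in H_n(d)\}\cong H_n(d)$; and, for every $j\in\{0,\dots,d-1\}$, $M_j^{(d)}$ is a homogeneous MSL over $R^{(d)}$ on the poset $\{g_{i_1\dots i_j}\}\cong H_n(j)$ with the poset ideals $\mathcal I(g_{i_1\dots i_j})$. 2. More precisely, for any linear forms $\ell_{ik}$ for which $R^{(d)}$ is a homogeneous ASL on $\{f_\alpha\}\cong H_n(d)$, and for every $j\in\{0,\dots,d-1\}$, $M_j^{(d)}$ is a homogeneous MSL over $R^{(d)}$ on $\{g_{i_1\dots i_j}\}\cong H_n(j)$ with the poset ideals $\mathcal I(g_{i_1\dots i_j})$. -/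

import Mathlib

open MvPolynomial

noncomputable section

/-! ### Algebras and modules with straightening laws -/

/-- Formal standard monomials on a poset `P`: finite weakly increasing sequences
`γ₁ ≤ γ₂ ≤ ... ≤ γ_t` in `P`, including the empty one. -/
abbrev StdMonomial (P : Type*) [PartialOrder P] : Type _ :=
  {l : List P // l.Pairwise (· ≤ ·)}

/-- The element `φ γ₁ * ... * φ γ_t` of `A` given by a standard monomial, where `φ` realizes
the poset `P` inside `A`. -/
def StdMonomial.toAlg {P A : Type*} [PartialOrder P] [CommRing A] (φ : P → A)
    (μ : StdMonomial P) : A :=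
  (μ.1.map φ).prod

/-- `A = ⨁ 𝒜 i` is a (graded) algebra with straightening laws over the field `K` on the finite
poset `P`, embedded in `A` by `φ`. -/
structure IsGradedASL (K : Type*) {A P : Type*} [Field K] [CommRing A] [Algebra K A]
    [PartialOrder P] (𝒜 : ℕ → Submodule K A) (φ : P → A) : Prop where
  finite : Finite P
  injective : Function.Injective φ
  gradedMonoid : SetLike.GradedMonoid 𝒜
  isInternal : DirectSum.IsInternal 𝒜
  degree_zero : 𝒜 0 = 1
  pos_degree : ∀ α, ∃ i, 0 < i ∧ φ α ∈ 𝒜 i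
  generates : Algebra.adjoin K (Set.range φ) = ⊤
  linearIndependent : LinearIndependent K (StdMonomial.toAlg φ)
  span_eq_top : Submodule.span K (Set.range (StdMonomial.toAlg φ)) = ⊤
  straightening : ∀ α β : P, ¬ α ≤ β → ¬ β ≤ α →
    ∀ r : StdMonomial P →₀ K,
      φ α * φ β = Finsupp.linearCombination K (StdMonomial.toAlg φ) r →
      ∀ μ ∈ r.support, ∃ γ, μ.1.head? = some γ ∧ γ < α ∧ γ < β

/-- A homogeneous ASL: all elements of the poset have degree one. -/
structure IsHomogeneousASL (K : Type*) {A P : Type*} [Field K] [CommRing A] [Algebra K A]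
    [PartialOrder P] (𝒜 : ℕ → Submodule K A) (φ : P → A) : Prop
    extends IsGradedASL K 𝒜 φ where
  degree_one : ∀ α, φ α ∈ 𝒜 1

/-- Formal standard elements `α₁ α₂ ⋯ α_i x`: an element `x` of `Q` and a (possibly empty)
sequence `α₁ ≤ ... ≤ α_i` in `P` with `α₁ ∉ I x`. -/
abbrev StdElement {P Q : Type*} [PartialOrder P] (I : Q → Set P) : Type _ :=
  (x : Q) × {μ : StdMonomial P // ∀ α, μ.1.head? = some α → α ∉ I x}

/-- The element of the module `M` given by a standard element. -/
def StdElement.toMod {P Q A M : Type*} [PartialOrder P] [CommRing A] [AddCommGroup M]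
    [Module A M] (φ : P → A) (ψ : Q → M) {I : Q → Set P} (e : StdElement I) : M :=
  StdMonomial.toAlg φ e.2.1 • ψ e.1

/-- `M` is a module with straightening laws on the finite poset `Q` (embedded in `M` by `ψ`) over
the ASL `A` on `P` (embedded in `A` by `φ`), with associated poset ideals `I x`, `x ∈ Q`. -/
structure IsMSL (K : Type*) {A P Q M : Type*} [Field K] [CommRing A] [Algebra K A]
    [PartialOrder P] [PartialOrder Q] [AddCommGroup M] [Module A M] [Module K M]
    [IsScalarTower K A M]
    (𝒜 : ℕ → Submodule K A) (φ : P → A) (ψ : Q → M) (I : Q → Set P) : Prop where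
  isASL : IsGradedASL K 𝒜 φ
  finite : Finite Q
  injective : Function.Injective ψ
  isPosetIdeal : ∀ x, IsLowerSet (I x)
  linearIndependent : LinearIndependent K (StdElement.toMod φ ψ (I := I))
  span_eq_top : Submodule.span K (Set.range (StdElement.toMod φ ψ (I := I))) = ⊤
  straightening : ∀ x, ∀ α ∈ I x, φ α • ψ x ∈ Submodule.span A (ψ '' {y | y < x})

/-- A homogeneous MSL: an MSL over a homogeneous ASL such that `M = ⨁ ℳ i` is a graded module
and all elements of the poset `Q` have degree zero. -/
structure IsHomogeneousMSL (K : Type*) {A P Q M : Type*} [Field K] [CommRing A] [Algebra K A]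
    [PartialOrder P] [PartialOrder Q] [AddCommGroup M] [Module A M] [Module K M]
    [IsScalarTower K A M]
    (𝒜 : ℕ → Submodule K A) (ℳ : ℕ → Submodule K M)
    (φ : P → A) (ψ : Q → M) (I : Q → Set P) : Prop
    extends IsMSL K 𝒜 φ ψ I where
  isHomogeneousASL : IsHomogeneousASL K 𝒜 φ
  gradedSMul : SetLike.GradedSMul 𝒜 ℳ
  isInternal : DirectSum.IsInternal ℳ
  degree_zero : ∀ x, ψ x ∈ ℳ 0

/-! ### Veronese algebra and Veronese modules of a polynomial ring -/

/-- The Veronese algebra `R^{(d)} = ⨁ R_{di}` of `R = K[x₁, ..., x_n]`: the polynomials all of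
whose monomials have degree of the form `d * i`. -/
def veroneseAlgebra (K : Type*) [Field K] (n d : ℕ) : Subalgebra K (MvPolynomial (Fin n) K) where
  carrier := {p | ∀ m ∈ p.support, ∃ i, m.degree = d * i}
  mul_mem' := by
    classical
    intro p q hp hq m hm
    obtain ⟨a, ha, b, hb, rfl⟩ := Finset.mem_add.1 (support_mul p q hm)
    obtain ⟨i, hi⟩ := hp a ha
    obtain ⟨k, hk⟩ := hq b hb
    exact ⟨i + k, by rw [map_add, hi, hk, mul_add]⟩
  add_mem' := by
    classical
    intro p q hp hq m hm
    rcases Finset.mem_union.1 (support_add hm) with h | h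
    · exact hp m h
    · exact hq m h
  algebraMap_mem' := by
    intro r m hm
    have h : m = 0 := by
      by_contra h0
      rw [mem_support_iff, algebraMap_eq, coeff_C, if_neg (Ne.symm h0)] at hm
      exact hm rfl
    exact ⟨0, by simp [h]⟩

/-- The `j`-th Veronese module `M_j^{(d)} = ⨁ R_{di+j}`, as an `R^{(d)}`-submodule of `R`. -/
def veroneseModule (K : Type*) [Field K] (n d j : ℕ) :
    Submodule (veroneseAlgebra K n d) (MvPolynomial (Fin n) K) where
  carrier := {p | ∀ m ∈ p.support, ∃ i, m.degree = d * i + j}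
  zero_mem' := by
    intro m hm
    simp at hm
  add_mem' := by
    classical
    intro p q hp hq m hm
    rcases Finset.mem_union.1 (support_add hm) with h | h
    · exact hp m h
    · exact hq m h
  smul_mem' := by
    classical
    intro a p hp m hm
    rw [Subalgebra.smul_def, smul_eq_mul] at hm
    obtain ⟨u, hu, v, hv, rfl⟩ := Finset.mem_add.1 (support_mul _ _ hm)
    obtain ⟨i, hi⟩ := a.2 u hu
    obtain ⟨k, hk⟩ := hp v hv
    exact ⟨i + k, by rw [map_add, hi, hk, mul_add, add_assoc]⟩

instance veroneseModule.instModule (K : Type*) [Field K] (n d j : ℕ) :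
    Module (veroneseAlgebra K n d) (veroneseModule K n d j) :=
  Submodule.module _

instance veroneseModule.instSMul (K : Type*) [Field K] (n d j : ℕ) :
    SMul (veroneseAlgebra K n d) (veroneseModule K n d j) :=
  (veroneseModule.instModule K n d j).toSMul

instance veroneseModule.instModuleBase (K : Type*) [Field K] (n d j : ℕ) :
    Module K (veroneseModule K n d j) :=
  Submodule.module' _

instance veroneseModule.instIsScalarTower (K : Type*) [Field K] (n d j : ℕ) :
    IsScalarTower K (veroneseAlgebra K n d) (veroneseModule K n d j) :=
  ⟨fun a b x => Subtype.ext (smul_assoc a b (x : MvPolynomial (Fin n) K))⟩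

/-- The grading of `R^{(d)}`: its component of degree `i` is `R_{di}`. -/
def veroneseAlgebraGrading (K : Type*) [Field K] (n d i : ℕ) :
    Submodule K (veroneseAlgebra K n d) :=
  (homogeneousSubmodule (Fin n) K (d * i)).comap (veroneseAlgebra K n d).val.toLinearMap

/-- The grading of `M_j^{(d)}`: its component of degree `i` is `R_{di+j}`. -/
def veroneseModuleGrading (K : Type*) [Field K] (n d j i : ℕ) :
    Submodule K (veroneseModule K n d j) :=
  (homogeneousSubmodule (Fin n) K (d * i + j)).comap
    ((veroneseModule K n d j).subtype.restrictScalars K)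

/-! ### The posets and the generators built from linear forms -/

/-- The poset `H_n(d)` of all `α ∈ {1, ..., n}^d` with `α₁ + ... + α_d ≤ n + d - 1`, ordered
componentwise. The element `a : Fin n` stands for the number `a + 1` of `{1, ..., n}`. -/
abbrev VeronesePoset (n d : ℕ) : Type :=
  {α : Fin d → Fin n // ∑ k, ((α k : ℕ) + 1) ≤ n + d - 1}

/-- The linear form `ℓ_{ij} = ∑ c_{ijk} x_k`. -/
def linForm {K : Type*} [Field K] {n d : ℕ} (c : Fin n → Fin d → Fin n → K)
    (i : Fin n) (j : Fin d) : MvPolynomial (Fin n) K :=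
  ∑ k, C (c i j k) * X k

theorem linForm_isHomogeneous {K : Type*} [Field K] {n d : ℕ} (c : Fin n → Fin d → Fin n → K)
    (i : Fin n) (j : Fin d) : (linForm c i j).IsHomogeneous 1 := by
  refine IsHomogeneous.sum _ _ _ fun k _ => ?_
  simpa using (isHomogeneous_C (Fin n) (c i j k)).mul (isHomogeneous_X K k)

theorem prod_linForm_isHomogeneous {K : Type*} [Field K] {n d j : ℕ}
    (c : Fin n → Fin d → Fin n → K) (s : Fin j → Fin n) (e : Fin j → Fin d) :
    (∏ k, linForm c (s k) (e k)).IsHomogeneous j := by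
  simpa using IsHomogeneous.prod Finset.univ (fun k => linForm c (s k) (e k)) (fun _ => 1)
    fun k _ => linForm_isHomogeneous c (s k) (e k)

/-- The generator `f_α = ℓ_{α₁ 1} ⋯ ℓ_{α_d d}` of `R^{(d)}`. -/
def veroneseAlgebraGen {K : Type*} [Field K] {n d : ℕ} (c : Fin n → Fin d → Fin n → K)
    (α : VeronesePoset n d) : veroneseAlgebra K n d :=
  ⟨∏ k, linForm c (α.1 k) k, fun m hm => ⟨1, by
    have h := prod_linForm_isHomogeneous c α.1 id (mem_support_iff.1 hm)
    rw [Finsupp.degree_eq_weight_one, mul_one]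
    exact h⟩⟩

/-- The generator `g_i = ℓ_{i₁ 1} ⋯ ℓ_{i_j j}` of `M_j^{(d)}`, for `j ≤ d`. -/
def veroneseModuleGen {K : Type*} [Field K] {n d j : ℕ} (hj : j ≤ d)
    (c : Fin n → Fin d → Fin n → K) (s : VeronesePoset n j) : veroneseModule K n d j :=
  ⟨∏ k, linForm c (s.1 k) (Fin.castLE hj k), fun m hm => ⟨0, by
    have h := prod_linForm_isHomogeneous c s.1 (Fin.castLE hj) (mem_support_iff.1 hm)
    rw [Finsupp.degree_eq_weight_one, mul_zero, zero_add]
    exact h⟩⟩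

/-- The tuple `(i₁, ..., i_j, 1, ..., 1)` of length `d`; note that `0 : Fin n` stands for `1`. -/
def padOne {n j : ℕ} [NeZero n] (d : ℕ) (s : Fin j → Fin n) : Fin d → Fin n :=
  fun k => if h : (k : ℕ) < j then s ⟨k, h⟩ else 0

/-- The poset ideal `I(g_i) = {f_α : α ≱ (i₁, ..., i_j, 1, ..., 1)}`, as a subset of `H_n(d)`. -/
def veroneseIdeal {n j : ℕ} [NeZero n] (d : ℕ) (s : VeronesePoset n j) :
    Set (VeronesePoset n d) :=
  {α | ¬ padOne d s.1 ≤ α.1}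

/-- The linear forms `ℓ_{1 σ(1)}, ..., ℓ_{n σ(n)}` are linearly independent for every
`σ : {1, ..., n} → {1, ..., d}`. -/
def TransversalsIndependent {K : Type*} [Field K] {n d : ℕ}
    (c : Fin n → Fin d → Fin n → K) : Prop :=
  ∀ σ : Fin n → Fin d, LinearIndependent K fun i => linForm c i (σ i)

/-- A property of families of linear forms `ℓ_{ij}` holds for generic forms: it holds on a
nonempty principal Zariski open subset of the space of coefficients `c_{ijk}`
(nonempty when `K` is infinite). -/
def HoldsGenerically (K : Type*) [Field K] (n d : ℕ)
    (p : (Fin n → Fin d → Fin n → K) → Prop) : Prop :=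
  ∃ Φ : MvPolynomial (Fin n × Fin d × Fin n) K, Φ ≠ 0 ∧
    ∀ c : Fin n → Fin d → Fin n → K, eval (fun t => c t.1 t.2.1 t.2.2) Φ ≠ 0 → p c

end

noncomputable section

/-! ### Products of linear forms arranged in columns -/

section Columns

variable {K : Type*} [Field K] {n d m m' : ℕ}

/-- The linear form with a given coefficient vector. -/
def linPoly (K : Type*) [Field K] (m : ℕ) : (Fin m → K) →ₗ[K] MvPolynomial (Fin m) K where
  toFun v := ∑ k, C (v k) * X k
  map_add' v w := by simp [add_mul, Finset.sum_add_distrib]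
  map_smul' a v := by simp [Finset.mul_sum, MvPolynomial.smul_eq_C_mul, mul_assoc]

theorem linPoly_apply (v : Fin m → K) : linPoly K m v = ∑ k, C (v k) * X k := rfl

theorem linPoly_injective : Function.Injective (linPoly K m) := by
  classical
  intro v w h
  funext k
  have := congrArg (coeff (Finsupp.single k 1)) h
  simpa [linPoly_apply, coeff_sum, coeff_C_mul, coeff_X, Finsupp.single_left_inj] using this

theorem linPoly_isHomogeneous (v : Fin m → K) : (linPoly K m v).IsHomogeneous 1 := by
  refine IsHomogeneous.sum _ _ _ fun k _ => ?_
  simpa using (isHomogeneous_C (Fin m) (v k)).mul (isHomogeneous_X K k)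

/-- The algebra homomorphism that acts on linear forms as a given linear map. -/
def linSubst (T : (Fin m → K) →ₗ[K] (Fin m' → K)) :
    MvPolynomial (Fin m) K →ₐ[K] MvPolynomial (Fin m') K :=
  aeval fun k => linPoly K m' (T (Pi.single k 1))

theorem linSubst_linPoly (T : (Fin m → K) →ₗ[K] (Fin m' → K)) (v : Fin m → K) :
    linSubst T (linPoly K m v) = linPoly K m' (T v) := by
  conv_rhs => rw [← (LinearMap.sum_single_apply (fun _ => K) v), map_sum, map_sum]
  simp only [linPoly_apply v, map_sum, map_mul, linSubst, aeval_X, algHom_C, algebraMap_eq]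
  refine Finset.sum_congr rfl fun k _ => ?_
  have : (Pi.single k (v k) : Fin m → K) = v k • (Pi.single k 1 : Fin m → K) := by
    ext l; simp [Pi.single_apply]
  rw [this, map_smul, map_smul, MvPolynomial.smul_eq_C_mul]

/-- The product of the linear forms `w k i`, where `i` runs over the `k`-th column of `e`. -/
def colProd (w : Fin d → Fin n → Fin m → K) (e : Fin d → Multiset (Fin n)) :
    MvPolynomial (Fin m) K :=
  ∏ k, ((e k).map fun i => linPoly K m (w k i)).prod

theorem colProd_add (w : Fin d → Fin n → Fin m → K) (e f : Fin d → Multiset (Fin n)) :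
    colProd w (e + f) = colProd w e * colProd w f := by
  simp [colProd, Finset.prod_mul_distrib]

theorem colProd_zero (w : Fin d → Fin n → Fin m → K) : colProd w 0 = 1 := by
  simp [colProd]

theorem colProd_single (w : Fin d → Fin n → Fin m → K) (k : Fin d) (i : Fin n) :
    colProd w (Pi.single k {i}) = linPoly K m (w k i) := by
  rw [colProd, Finset.prod_eq_single k]
  · simp
  · intro l _ hl; simp [hl]
  · simp

theorem linSubst_colProd (T : (Fin m → K) →ₗ[K] (Fin m' → K)) (w : Fin d → Fin n → Fin m → K)
    (e : Fin d → Multiset (Fin n)) :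
    linSubst T (colProd w e) = colProd (fun k i => T (w k i)) e := by
  simp [colProd, map_prod, map_multiset_prod, Multiset.map_map, linSubst_linPoly]

theorem colProd_isHomogeneous (w : Fin d → Fin n → Fin m → K) (e : Fin d → Multiset (Fin n)) :
    (colProd w e).IsHomogeneous (∑ k, (e k).card) := by
  refine IsHomogeneous.prod _ _ _ fun k _ => ?_
  induction e k using Multiset.induction with
  | empty => simpa using isHomogeneous_one (Fin m) K
  | cons a s ih =>
    rw [Multiset.map_cons, Multiset.prod_cons, Multiset.card_cons, add_comm]
    exact (linPoly_isHomogeneous _).mul ih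

theorem colProd_eq_zero_of_mem {w : Fin d → Fin n → Fin m → K} {e : Fin d → Multiset (Fin n)}
    {k : Fin d} {i : Fin n} (hi : i ∈ e k) (h : w k i = 0) : colProd w e = 0 := by
  refine Finset.prod_eq_zero (Finset.mem_univ k) (Multiset.prod_eq_zero ?_)
  exact Multiset.mem_map.2 ⟨i, hi, by rw [h, map_zero]⟩

/-- Families of columns with column lengths `t` whose entries exceed the lower bounds `s` by
amounts adding up to less than `m`. -/
def stdCols (n : ℕ) (s : Fin d → ℕ) (m : ℕ) (t : Fin d → ℕ) : Set (Fin d → Multiset (Fin n)) :=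
  {e | (∀ k, (e k).card = t k) ∧ ∃ b : Fin d → ℕ, ∑ k, b k < m ∧
    ∀ k, ∀ i ∈ e k, s k ≤ i ∧ (i : ℕ) ≤ s k + b k}

/-- Initial segments (starting at `s`) of the columns of `w`, of total length at most `m`, are
linearly independent. -/
def FlagIndependent (s : Fin d → ℕ) (m : ℕ) (w : Fin d → Fin n → Fin m' → K) : Prop :=
  ∀ b : Fin d → ℕ, ∑ k, b k ≤ m →
    LinearIndepOn K (fun q : Fin d × Fin n => w q.1 q.2)
      {q | s q.1 ≤ q.2 ∧ (q.2 : ℕ) < s q.1 + b q.1}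

theorem exists_linearMap_ker_eq_span (v : Fin (m + 1) → K) (hv : v ≠ 0) :
    ∃ T : (Fin (m + 1) → K) →ₗ[K] (Fin m → K), LinearMap.ker T = K ∙ v := by
  have h1 : Module.finrank K ((Fin (m + 1) → K) ⧸ (K ∙ v)) = Module.finrank K (Fin m → K) := by
    have := Submodule.finrank_quotient_add_finrank (K ∙ v)
    rw [finrank_span_singleton hv] at this
    simp at this ⊢
    omega
  let φ := LinearEquiv.ofFinrankEq _ _ h1
  exact ⟨φ.toLinearMap ∘ₗ (K ∙ v).mkQ, by rw [LinearEquiv.ker_comp, Submodule.ker_mkQ]⟩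

theorem FlagIndependent.exists_step {s : Fin d → ℕ} {w : Fin d → Fin n → Fin (m + 1) → K}
    (h : FlagIndependent s (m + 1) w) (k : Fin d) (i : Fin n) (hi : (i : ℕ) = s k) :
    ∃ T : (Fin (m + 1) → K) →ₗ[K] (Fin m → K), T (w k i) = 0 ∧
      FlagIndependent (s + Pi.single k 1) m fun k i => T (w k i) := by
  have hne : w k i ≠ 0 := by
    have := (h (Pi.single k 1) (by simp)).ne_zero (i := (k, i)) (by simp [hi])
    exact this
  obtain ⟨T, hT⟩ := exists_linearMap_ker_eq_span _ hne
  refine ⟨T, ?_, fun b hb => ?_⟩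
  · rw [← LinearMap.mem_ker, hT]; exact Submodule.mem_span_singleton_self _
  have h1 := h (b + Pi.single k 1) (by simpa [Finset.sum_add_distrib] using hb)
  set S : Set (Fin d × Fin n) := {q | (s + Pi.single k 1 : Fin d → ℕ) q.1 ≤ q.2 ∧
    (q.2 : ℕ) < (s + Pi.single k 1 : Fin d → ℕ) q.1 + b q.1} with hS
  have h2 : {q : Fin d × Fin n | s q.1 ≤ q.2 ∧
      (q.2 : ℕ) < s q.1 + (b + Pi.single k 1 : Fin d → ℕ) q.1} = insert (k, i) S := by
    ext ⟨l, j⟩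
    by_cases hl : l = k
    · subst hl
      simp [hS, Fin.ext_iff]
      omega
    · simp [hS, hl]
  have h3 : (k, i) ∉ S := by simp [hS, hi]
  rw [h2, linearIndepOn_insert h3] at h1
  refine LinearIndependent.map (f := T) h1.1 ?_
  rw [hT, Submodule.disjoint_span_singleton' hne]
  rw [Set.image_eq_range] at h1
  exact h1.2

theorem FlagIndependent.exists_column {w : Fin d → Fin n → Fin n → K}
    (h : FlagIndependent 0 n w) (k : Fin d) (r : ℕ) : ∀ m, r + m = n →
    ∃ T : (Fin n → K) →ₗ[K] (Fin m → K), (∀ i : Fin n, (i : ℕ) < r → T (w k i) = 0) ∧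
      FlagIndependent (Pi.single k r) m fun k i => T (w k i) := by
  induction r with
  | zero =>
    rintro m hm
    obtain rfl : m = n := by omega
    exact ⟨LinearMap.id, by simp, by simpa using h⟩
  | succ r ih =>
    intro m hm
    obtain ⟨T, hT, hf⟩ := ih (m + 1) (by omega)
    obtain ⟨T', hT', hf'⟩ := hf.exists_step k ⟨r, by omega⟩ (by simp)
    refine ⟨T' ∘ₗ T, fun i hi => ?_, ?_⟩
    · rcases Nat.lt_succ_iff_lt_or_eq.1 hi with hi | hi
      · simp [hT i hi]
      · rw [show i = ⟨r, by omega⟩ from Fin.ext hi]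
        simpa using hT'
    · rwa [← Pi.single_add] at hf'

/-- The recursive structure of `stdCols`. -/
theorem stdCols_succ {s t : Fin d → ℕ} (k : Fin d) (i : Fin n) (hi : (i : ℕ) = s k) :
    stdCols n s (m + 1) (t + Pi.single k 1) =
      (fun e => e + Pi.single k {i}) '' stdCols n s (m + 1) t ∪
        stdCols n (s + Pi.single k 1) m (t + Pi.single k 1) := by
  ext e
  constructor
  · rintro ⟨hc, b, hb, hbe⟩
    by_cases hmem : i ∈ e k
    · left
      obtain ⟨u, hu⟩ := Multiset.exists_cons_of_mem hmem
      have he : Function.update e k u + Pi.single k {i} = e := by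
        ext1 l
        by_cases hl : l = k
        · subst hl
          simp [hu, ← Multiset.singleton_add, add_comm]
        · simp [hl]
      refine ⟨Function.update e k u, ⟨fun l => ?_, b, hb, fun l j hj => hbe l j ?_⟩, he⟩
      · have := hc l
        rw [← he] at this
        by_cases hl : l = k
        · subst hl; simpa using this
        · simpa [hl] using this
      · rw [← he, Pi.add_apply]
        exact Multiset.mem_add.2 (Or.inl hj)
    · right
      have hlow : ∀ j ∈ e k, s k + 1 ≤ j := by
        intro j hj
        refine lt_of_le_of_ne (hbe k j hj).1 fun h => hmem ?_
        rwa [show i = j from Fin.ext (hi.trans h)]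
      obtain ⟨j₀, hj₀⟩ : ∃ j, j ∈ e k := by
        refine Multiset.card_pos_iff_exists_mem.1 ?_
        rw [hc k]; simp
      have hbk : 1 ≤ b k := by
        have := hlow j₀ hj₀; have := (hbe k j₀ hj₀).2; omega
      obtain ⟨b', rfl⟩ : ∃ b', b = b' + Pi.single k 1 := by
        refine ⟨b - Pi.single k 1, (tsub_add_cancel_of_le ?_).symm⟩
        intro l
        by_cases hl : l = k
        · subst hl; simpa using hbk
        · simp [hl]
      refine ⟨hc, b', by simpa [Finset.sum_add_distrib] using hb, fun l j hj => ?_⟩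
      have := (hbe l j hj).2
      have h3 := (hbe l j hj).1
      by_cases hl : l = k
      · subst hl
        have := hlow j hj
        simp only [Pi.add_apply, Pi.single_eq_same] at *
        omega
      · simpa [hl] using ⟨h3, by simpa [hl] using this⟩
  · rintro (⟨e, ⟨hc, b, hb, hbe⟩, rfl⟩ | ⟨hc, b, hb, hbe⟩)
    · refine ⟨fun l => ?_, b, hb, fun l j hj => ?_⟩
      · by_cases hl : l = k
        · subst hl; simp [hc]
        · simp [hl, hc]
      · rcases Multiset.mem_add.1 hj with hj | hj
        · exact hbe l j hj
        · by_cases hl : l = k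
          · subst hl
            simp at hj
            subst hj
            omega
          · simp [hl] at hj
    · refine ⟨hc, b + Pi.single k 1, by simpa [Finset.sum_add_distrib] using hb, fun l j hj => ?_⟩
      have := hbe l j hj
      simp only [Pi.add_apply] at *
      omega

theorem disjoint_stdCols {s t : Fin d → ℕ} (k : Fin d) (i : Fin n) (hi : (i : ℕ) = s k)
    (A : Set (Fin d → Multiset (Fin n))) :
    Disjoint ((fun e => e + Pi.single k {i}) '' A) (stdCols n (s + Pi.single k 1) m t) := by
  rw [Set.disjoint_left]
  rintro _ ⟨e, -, rfl⟩ ⟨-, b, -, hbe⟩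
  have := (hbe k i (by simp)).1
  simp at this
  omega

theorem exists_eq_add_single {t : Fin d → ℕ} {N : ℕ} (ht : ∑ k, t k = N + 1) :
    ∃ (k : Fin d) (t' : Fin d → ℕ), t = t' + Pi.single k 1 ∧ ∑ k, t' k = N := by
  obtain ⟨k, hk⟩ : ∃ k, t k ≠ 0 := by
    by_contra! h
    simp [h] at ht
  have : t = (t - Pi.single k 1) + Pi.single k 1 := by
    refine (tsub_add_cancel_of_le fun l => ?_).symm
    by_cases hl : l = k
    · subst hl; simp; omega
    · simp [hl]
  refine ⟨k, _, this, ?_⟩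
  rw [this] at ht
  simpa [Finset.sum_add_distrib] using ht

theorem stdCols_zero (s t : Fin d → ℕ) : stdCols n s 0 t = ∅ := by
  ext e; simp [stdCols]

theorem stdCols_of_sum_eq_zero {s t : Fin d → ℕ} (ht : ∑ k, t k = 0) :
    stdCols n s (m + 1) t = {0} := by
  have ht : t = 0 := by
    funext k; exact (Finset.sum_eq_zero_iff.1 ht) k (Finset.mem_univ k)
  subst ht
  ext e
  constructor
  · rintro ⟨hc, -⟩
    funext k
    simpa using hc k
  · rintro rfl
    exact ⟨by simp, 0, by simp, by simp⟩

theorem lt_of_add_sum_le {s : Fin d → ℕ} (hs : ∑ k, s k + (m + 1) ≤ n) (k : Fin d) : s k < n := by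
  have := Finset.single_le_sum (f := s) (fun _ _ => Nat.zero_le _) (Finset.mem_univ k)
  omega

theorem disjoint_span_image_ker {ι M M' : Type*} [AddCommGroup M] [AddCommGroup M'] [Module K M]
    [Module K M'] {f : M →ₗ[K] M'} {v : ι → M} {s : Set ι} (h : LinearIndepOn K (f ∘ v) s) :
    Disjoint (Submodule.span K (v '' s)) (LinearMap.ker f) := by
  rw [Set.image_eq_range]
  exact Submodule.range_ker_disjoint (f := f) (v := fun i : s => v i) h

theorem linearIndepOn_colProd : ∀ (m : ℕ) (s : Fin d → ℕ) (w : Fin d → Fin n → Fin m → K),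
    ∑ k, s k + m ≤ n → FlagIndependent s m w → ∀ t, LinearIndepOn K (colProd w) (stdCols n s m t) := by
  intro m
  induction m with
  | zero => intro s w _ _ t; rw [stdCols_zero]; exact linearIndepOn_empty _ _
  | succ m ihm =>
    intro s w hs hw t
    obtain ⟨N, hN⟩ : ∃ N, ∑ k, t k = N := ⟨_, rfl⟩
    induction N generalizing t with
    | zero =>
      rw [stdCols_of_sum_eq_zero hN]
      exact LinearIndepOn.singleton (by simp [colProd_zero])
    | succ N ihN =>
      obtain ⟨k, t, rfl, ht⟩ := exists_eq_add_single hN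
      obtain ⟨i, hi⟩ : ∃ i : Fin n, (i : ℕ) = s k := ⟨⟨s k, lt_of_add_sum_le hs k⟩, rfl⟩
      obtain ⟨T, hT0, hT⟩ := hw.exists_step k i hi
      have hwne : w k i ≠ 0 := (hw (Pi.single k 1) (by simp)).ne_zero (i := (k, i)) (by simp [hi])
      have h1 := ihm (s + Pi.single k 1) _ (by simp [Finset.sum_add_distrib]; omega) hT
        (t + Pi.single k 1)
      have h1' : LinearIndepOn K ((linSubst T).toLinearMap ∘ colProd w)
          (stdCols n (s + Pi.single k 1) m (t + Pi.single k 1)) := by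
        refine h1.congr fun e _ => ?_
        exact (linSubst_colProd T w e).symm
      have hlp : linPoly K (m + 1) (w k i) ≠ 0 := by
        rwa [Ne, LinearMap.map_eq_zero_iff _ linPoly_injective]
      rw [stdCols_succ k i hi]
      refine LinearIndepOn.union ?_ (LinearIndepOn.of_comp _ h1') ?_
      · refine LinearIndepOn.image_of_comp _ _ ?_
        have hinj : Function.Injective (LinearMap.mulRight K (linPoly K (m + 1) (w k i))) :=
          fun _ _ h => mul_right_cancel₀ hlp h
        refine ((ihN t ht).map_injOn _ hinj.injOn).congr fun e _ => ?_
        simp [colProd_add, colProd_single]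
      · refine Disjoint.mono_left ?_ (disjoint_span_image_ker h1').symm
        rw [Submodule.span_le]
        rintro _ ⟨_, ⟨e, -, rfl⟩, rfl⟩
        simp [colProd_add, colProd_single, linSubst_linPoly, hT0]

theorem ncard_stdCols : ∀ (m : ℕ) (s t : Fin d → ℕ), ∑ k, s k + m ≤ n → 0 < m + ∑ k, t k →
    (stdCols n s m t).Finite ∧ (stdCols n s m t).ncard = Nat.multichoose m (∑ k, t k) := by
  intro m
  induction m with
  | zero =>
    intro s t _ ht
    rw [stdCols_zero]
    obtain ⟨N, hN⟩ := Nat.exists_eq_succ_of_ne_zero (n := ∑ k, t k) (by omega)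
    simp [hN]
  | succ m ihm =>
    intro s t hs _
    obtain ⟨N, hN⟩ : ∃ N, ∑ k, t k = N := ⟨_, rfl⟩
    induction N generalizing t with
    | zero =>
      rw [stdCols_of_sum_eq_zero hN, hN]
      simp
    | succ N ihN =>
      obtain ⟨k, t, rfl, ht⟩ := exists_eq_add_single hN
      obtain ⟨i, hi⟩ : ∃ i : Fin n, (i : ℕ) = s k := ⟨⟨s k, lt_of_add_sum_le hs k⟩, rfl⟩
      obtain ⟨f1, c1⟩ := ihm (s + Pi.single k 1) (t + Pi.single k 1)
        (by simp [Finset.sum_add_distrib]; omega) (by omega)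
      obtain ⟨f2, c2⟩ := ihN t (by omega) ht
      rw [stdCols_succ k i hi]
      refine ⟨(f2.image _).union f1, ?_⟩
      rw [Set.ncard_union_eq (disjoint_stdCols k i hi _) (f2.image _) f1,
        Set.ncard_image_of_injective _ (add_left_injective _), c1, c2, hN, ht,
        Nat.multichoose_succ_succ, add_comm]

theorem finrank_homogeneousSubmodule (n N : ℕ) :
    Module.finrank K (homogeneousSubmodule (Fin n) K N) = Nat.multichoose n N := by
  classical
  rw [homogeneousSubmodule_eq_finsupp_supported,
    (AddMonoidAlgebra.supportedEquivFinsupp (R := K) (S := K)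
      {x : Fin n →₀ ℕ | x.degree = N}).finrank_eq]
  have h : {x : Fin n →₀ ℕ | x.degree = N} =
      ((Finset.univ : Finset (Fin n)).finsuppAntidiag N : Finset (Fin n →₀ ℕ)) := by
    ext x
    simp [Finsupp.degree_eq_sum]
  rw [h, Module.finrank_finsupp_self]
  simp [Finset.card_finsuppAntidiag_nat_eq_multichoose]

instance finite_homogeneousSubmodule (n N : ℕ) :
    Module.Finite K (homogeneousSubmodule (Fin n) K N) :=
  Module.Finite.iff_fg.2 (homogeneousSubmodule_fg (Fin n) K N)

theorem span_colProd_eq {w : Fin d → Fin n → Fin n → K} {t : Fin d → ℕ} (hn : 0 < n)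
    (h : LinearIndepOn K (colProd w) (stdCols n 0 n t)) :
    Submodule.span K (colProd w '' stdCols n 0 n t) = homogeneousSubmodule (Fin n) K (∑ k, t k) := by
  obtain ⟨hf, hc⟩ := ncard_stdCols (n := n) n 0 t (by simp) (by omega)
  refine Submodule.eq_of_le_of_finrank_eq ?_ ?_
  · rw [Submodule.span_le]
    rintro _ ⟨e, he, rfl⟩
    have := colProd_isHomogeneous w e
    rw [← Finset.sum_congr rfl fun k _ => he.1 k]; exact this
  · have := hf.fintype
    rw [finrank_homogeneousSubmodule, ← hc, Set.image_eq_range]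
    rw [finrank_span_eq_card h, ← Nat.card_eq_fintype_card, Nat.card_coe_set_eq]

end Columns

/-! ### Chains in `H_n(d)` and families of columns -/

section Chains

variable {K : Type*} [Field K] {n d : ℕ}

/-- The columns of a list of elements of `H_n(d)`. -/
def chainCols (l : List (VeronesePoset n d)) : Fin d → Multiset (Fin n) :=
  fun k => (l.map fun α => α.1 k : List (Fin n))

theorem chainCols_nil : chainCols ([] : List (VeronesePoset n d)) = 0 := rfl

theorem chainCols_cons (α : VeronesePoset n d) (l : List (VeronesePoset n d)) :
    chainCols (α :: l) = (fun k => {α.1 k}) + chainCols l := rfl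

theorem card_chainCols (l : List (VeronesePoset n d)) (k : Fin d) :
    (chainCols l k).card = l.length := by
  simp [chainCols]

theorem mem_chainCols {l : List (VeronesePoset n d)} {k : Fin d} {i : Fin n} :
    i ∈ chainCols l k ↔ ∃ α ∈ l, α.1 k = i := by
  simp [chainCols]

theorem VeronesePoset.sum_lt [NeZero n] (α : VeronesePoset n d) : ∑ k, (α.1 k : ℕ) < n := by
  have h := α.2
  have := NeZero.pos n
  simp [Finset.sum_add_distrib] at h
  omega

theorem chainCols_mem_stdCols [NeZero n] (μ : StdMonomial (VeronesePoset n d)) (hμ : μ.1 ≠ [])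
    {s : Fin d → ℕ} {m : ℕ} (hm : ∑ k, s k + m = n) (hs : ∀ α ∈ μ.1, ∀ k, s k ≤ α.1 k) :
    chainCols μ.1 ∈ stdCols n s m fun _ => μ.1.length := by
  refine ⟨card_chainCols μ.1, fun k => (μ.1.getLast hμ).1 k - s k, ?_, fun k i hi => ?_⟩ <;> beta_reduce
  · have h1 : ∑ k, (((μ.1.getLast hμ).1 k : ℕ) - s k) + ∑ k, s k =
        ∑ k, ((μ.1.getLast hμ).1 k : ℕ) := by
      rw [← Finset.sum_add_distrib]
      exact Finset.sum_congr rfl fun k _ => Nat.sub_add_cancel (hs _ (List.getLast_mem hμ) k)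
    have := (μ.1.getLast hμ).sum_lt
    omega
  · obtain ⟨α, hα, rfl⟩ := mem_chainCols.1 hi
    refine ⟨hs α hα k, ?_⟩
    have hle : α ≤ μ.1.getLast hμ := by
      have := μ.2
      rw [← List.dropLast_append_getLast hμ, List.pairwise_append] at this
      rw [← List.dropLast_append_getLast hμ, List.mem_append] at hα
      rcases hα with hα | hα
      · exact this.2.2 α hα _ (by simp)
      · simp at hα; exact hα.le
    have : (α.1 k : ℕ) ≤ (μ.1.getLast hμ).1 k := hle k
    have := hs α hα k
    omega

theorem chainCols_mem_stdCols_zero [NeZero n] (μ : StdMonomial (VeronesePoset n d)) :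
    chainCols μ.1 ∈ stdCols n 0 n fun _ => μ.1.length := by
  by_cases hμ : μ.1 = []
  · rw [hμ]
    exact ⟨by simp [chainCols], 0, by simpa using NeZero.pos n, by simp [chainCols]⟩
  · exact chainCols_mem_stdCols μ hμ (by simp) (by simp)

theorem chainCols_injOn (N : ℕ) : Set.InjOn (fun μ : StdMonomial (VeronesePoset n d) =>
    chainCols μ.1) {μ | μ.1.length = N} := by
  intro μ hμ ν hν h
  have hlen : μ.1.length = ν.1.length := hμ.trans hν.symm
  have hcol : ∀ k, μ.1.map (fun α => α.1 k) = ν.1.map fun α => α.1 k := by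
    intro k
    have hp : (μ.1.map fun α => α.1 k).Perm (ν.1.map fun α => α.1 k) :=
      Multiset.coe_eq_coe.1 (congrFun h k)
    refine hp.eq_of_pairwise (le := (· ≤ ·)) (fun a b _ _ => le_antisymm) ?_ ?_
    · exact List.pairwise_map.2 (μ.2.imp fun hab => hab k)
    · exact List.pairwise_map.2 (ν.2.imp fun hab => hab k)
  refine Subtype.ext (List.ext_getElem hlen fun r h1 h2 => Subtype.ext (funext fun k => ?_))
  have := List.getElem_of_eq (hcol k) (i := r) (by simpa using h1)
  simpa using this

theorem exists_chainCols_eq [NeZero n] {N : ℕ} {e : Fin d → Multiset (Fin n)}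
    (he : e ∈ stdCols n 0 n fun _ => N) :
    ∃ μ : StdMonomial (VeronesePoset n d), μ.1.length = N ∧ chainCols μ.1 = e := by
  obtain ⟨hc, b, hb, hbe⟩ := he
  have hlen : ∀ k, ((e k).sort (· ≤ ·)).length = N := fun k => by simp [hc]
  have hbd : ∀ r : Fin N, ∑ k, ((((e k).sort (· ≤ ·))[(r : ℕ)]'(by simp [hlen]) : Fin n) + 1 : ℕ) ≤
      n + d - 1 := by
    intro r
    have : ∑ k, ((((e k).sort (· ≤ ·))[(r : ℕ)]'(by simp [hlen]) : Fin n) : ℕ) ≤ ∑ k, b k := by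
      refine Finset.sum_le_sum fun k _ => ?_
      have := (hbe k (((e k).sort (· ≤ ·))[(r : ℕ)]'(by simp [hlen]))
        ((Multiset.mem_sort (· ≤ ·)).1 (List.getElem_mem _))).2
      simpa using this
    rw [Finset.sum_add_distrib]
    simp only [Finset.sum_const, Finset.card_univ, Fintype.card_fin, smul_eq_mul, mul_one]
    omega
  refine ⟨⟨List.ofFn fun r : Fin N => (⟨fun k => ((e k).sort (· ≤ ·))[(r : ℕ)]'(by simp [hlen]),
    hbd r⟩ : VeronesePoset n d), ?_⟩, by simp, ?_⟩
  · rw [List.pairwise_ofFn]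
    intro i j hij k
    exact List.pairwise_iff_getElem.1 (Multiset.pairwise_sort (e k) (· ≤ ·)) _ _ _ _ hij
  · funext k
    conv_rhs => rw [← Multiset.sort_eq (e k) (· ≤ ·)]
    refine congrArg _ (List.ext_getElem (by simp [hlen]) fun r h1 h2 => by simp)

theorem coe_toAlg_veroneseAlgebraGen (c : Fin n → Fin d → Fin n → K)
    (μ : StdMonomial (VeronesePoset n d)) :
    ((StdMonomial.toAlg (veroneseAlgebraGen c) μ : veroneseAlgebra K n d) :
      MvPolynomial (Fin n) K) =
      colProd (fun k i => c i k) (chainCols μ.1) := by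
  obtain ⟨l, hl⟩ := μ
  change ((l.map _).prod : veroneseAlgebra K n d).1 = colProd _ (chainCols l)
  clear hl
  induction l with
  | nil => simp [chainCols_nil, colProd_zero]
  | cons α l ih =>
    rw [chainCols_cons, colProd_add, ← ih, List.map_cons, List.prod_cons, Subalgebra.coe_mul]
    simp [colProd, veroneseAlgebraGen, linForm, linPoly_apply]

end Chains

/-! ### The gradings -/

section Grading

variable {K : Type*} [Field K] {n d : ℕ}

theorem isInternal_comap_homogeneousSubmodule {M : Type*} [AddCommGroup M] [Module K M]
    (ι : M →ₗ[K] MvPolynomial (Fin n) K) (hι : Function.Injective ι) {f : ℕ → ℕ}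
    (hf : Function.Injective f)
    (hM : ∀ p, p ∈ LinearMap.range ι ↔ ∀ m ∈ p.support, ∃ i, m.degree = f i) :
    DirectSum.IsInternal fun i => (homogeneousSubmodule (Fin n) K (f i)).comap ι := by
  rw [DirectSum.isInternal_submodule_iff_iSupIndep_and_iSup_eq_top]
  constructor
  · rw [iSupIndep_iff_finsetSum_eq_zero_imp_eq_zero]
    intro s v hv h0 i hi
    have h1 := congrArg (homogeneousComponent (f i)) (congrArg ι h0)
    rw [map_sum, map_sum, Finset.sum_eq_single i, map_zero, map_zero,
      homogeneousComponent_of_mem (hv i hi), if_pos rfl] at h1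
    · exact (LinearMap.map_eq_zero_iff ι hι).1 h1
    · intro l hl hli
      rw [homogeneousComponent_of_mem (hv l hl), if_neg fun h => hli (hf h).symm]
    · exact fun h => absurd hi h
  · rw [eq_top_iff]
    rintro x -
    have hx := (hM (ι x)).1 ⟨x, rfl⟩
    have hcomp : ∀ N, ∃ y ∈ ⨆ i, (homogeneousSubmodule (Fin n) K (f i)).comap ι,
        ι y = homogeneousComponent N (ι x) := by
      intro N
      by_cases h : ∃ i, N = f i
      · obtain ⟨i, rfl⟩ := h
        have hhom := homogeneousComponent_isHomogeneous (f i) (ι x)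
        obtain ⟨y, hy⟩ := (hM (homogeneousComponent (f i) (ι x))).2 fun m hm => ⟨i, by
          rw [Finsupp.degree_eq_weight_one]; exact hhom (mem_support_iff.1 hm)⟩
        refine ⟨y, Submodule.mem_iSup_of_mem i ?_, hy⟩
        rw [Submodule.mem_comap, hy]
        exact hhom
      · refine ⟨0, zero_mem _, ?_⟩
        rw [map_zero, eq_comm]
        ext m
        rw [coeff_homogeneousComponent, coeff_zero]
        split_ifs with hm
        · by_contra hne
          obtain ⟨i, hi⟩ := hx m (mem_support_iff.2 hne)
          exact h ⟨i, hm.symm.trans hi⟩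
        · rfl
    choose y hy hyx using hcomp
    have : x = ∑ N ∈ Finset.range ((ι x).totalDegree + 1), y N := by
      refine hι ?_
      rw [map_sum, Finset.sum_congr rfl fun N _ => hyx N, sum_homogeneousComponent]
    rw [this]
    exact Submodule.sum_mem _ fun N _ => hy N

theorem isInternal_veroneseModuleGrading (hd : 0 < d) (j : ℕ) :
    DirectSum.IsInternal (veroneseModuleGrading K n d j) := by
  have hinj : Function.Injective fun i => d * i + j := fun a b h =>
    Nat.eq_of_mul_eq_mul_left hd (Nat.add_right_cancel h)
  have hrange : ∀ p, p ∈ LinearMap.range ((veroneseModule K n d j).subtype.restrictScalars K) ↔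
      ∀ m ∈ p.support, ∃ i, m.degree = d * i + j := fun p =>
    ⟨fun ⟨x, hx⟩ => hx ▸ x.2, fun h => ⟨⟨p, h⟩, rfl⟩⟩
  exact @isInternal_comap_homogeneousSubmodule K _ n (veroneseModule K n d j)
    (Submodule.addCommGroup _) (veroneseModule.instModuleBase K n d j)
    ((veroneseModule K n d j).subtype.restrictScalars K) Subtype.val_injective
    (fun i => d * i + j) hinj hrange

theorem isInternal_veroneseAlgebraGrading (hd : 0 < d) :
    DirectSum.IsInternal (veroneseAlgebraGrading K n d) := by
  refine isInternal_comap_homogeneousSubmodule (f := fun i => d * i) _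
    Subtype.val_injective (fun a b h => ?_) fun p => ?_
  · exact Nat.eq_of_mul_eq_mul_left hd h
  · exact ⟨fun ⟨x, hx⟩ => hx ▸ x.2, fun h => ⟨⟨p, h⟩, rfl⟩⟩

instance gradedMonoid_veroneseAlgebraGrading :
    SetLike.GradedMonoid (veroneseAlgebraGrading K n d) where
  one_mem := isHomogeneous_one (Fin n) K
  mul_mem i j x y hx hy := by
    have : (x.1 * y.1).IsHomogeneous (d * i + d * j) := IsHomogeneous.mul hx hy
    rw [← mul_add] at this
    exact this

instance gradedSMul_veroneseModuleGrading (j : ℕ) :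
    SetLike.GradedSMul (veroneseAlgebraGrading K n d) (veroneseModuleGrading K n d j) where
  smul_mem {a b} x y hx hy := by
    have : (x.1 * y.1).IsHomogeneous (d * a + (d * b + j)) := IsHomogeneous.mul hx hy
    rw [← add_assoc, ← mul_add] at this
    exact this

theorem veroneseAlgebraGrading_zero : veroneseAlgebraGrading K n d 0 = 1 := by
  ext x
  rw [Submodule.mem_one]
  constructor
  · intro hx
    have hx : x.1.IsHomogeneous 0 := hx
    refine ⟨coeff 0 x.1, Subtype.ext ?_⟩
    exact (totalDegree_eq_zero_iff_eq_C.1 ((totalDegree_zero_iff_isHomogeneous _).2 hx)).symm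
  · rintro ⟨a, rfl⟩
    exact isHomogeneous_C (Fin n) a

theorem veroneseAlgebraGen_mem (c : Fin n → Fin d → Fin n → K) (α : VeronesePoset n d) :
    veroneseAlgebraGen c α ∈ veroneseAlgebraGrading K n d 1 := by
  change MvPolynomial.IsHomogeneous _ (d * 1)
  rw [mul_one]
  exact prod_linForm_isHomogeneous c α.1 id

theorem veroneseModuleGen_mem {j : ℕ} (hj : j ≤ d) (c : Fin n → Fin d → Fin n → K)
    (x : VeronesePoset n j) : veroneseModuleGen hj c x ∈ veroneseModuleGrading K n d j 0 := by
  change MvPolynomial.IsHomogeneous _ (d * 0 + j)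
  rw [mul_zero, zero_add]
  exact prod_linForm_isHomogeneous c x.1 (Fin.castLE hj)

end Grading

/-! ### The Veronese algebra as an algebra with straightening laws -/

section VeroneseASL

variable {K : Type*} [Field K] {n d : ℕ}

theorem homogeneousComponent_linearCombination {ι : Type*} {v : ι → MvPolynomial (Fin n) K}
    {deg f : ι → ℕ} (hv : ∀ i, (v i).IsHomogeneous (f i)) (hf : ∀ i j, f i = f j ↔ deg i = deg j)
    (i₀ : ι) (l : ι →₀ K) :
    homogeneousComponent (f i₀) (Finsupp.linearCombination K v l) =
      Finsupp.linearCombination K v (l.filter fun i => deg i = deg i₀) := by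
  classical
  induction l using Finsupp.induction_linear with
  | zero => simp [Finsupp.filter_zero]
  | add a b ha hb => rw [map_add, map_add, ha, hb, Finsupp.filter_add, map_add]
  | single i a =>
    rw [Finsupp.linearCombination_single, map_smul, homogeneousComponent_of_mem (hv i)]
    by_cases h : deg i = deg i₀
    · rw [if_pos ((hf i₀ i).2 h.symm), Finsupp.filter_single_of_pos (fun i => deg i = deg i₀) h,
        Finsupp.linearCombination_single]
    · rw [if_neg fun h' => h ((hf i₀ i).1 h').symm, Finsupp.filter_single_of_neg (fun i => deg i = deg i₀) h, smul_zero,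
        map_zero]

theorem linearIndependent_of_isHomogeneous {ι : Type*} {v : ι → MvPolynomial (Fin n) K}
    {deg f : ι → ℕ} (hv : ∀ i, (v i).IsHomogeneous (f i)) (hf : ∀ i j, f i = f j ↔ deg i = deg j)
    (h : ∀ N, LinearIndepOn K v {i | deg i = N}) : LinearIndependent K v := by
  classical
  rw [linearIndependent_iff]
  intro l hl
  ext i
  have h1 := homogeneousComponent_linearCombination hv hf i l
  rw [hl, map_zero] at h1
  have h2 := linearIndepOn_iff.1 (h (deg i)) (l.filter fun j => deg j = deg i)
    (fun j hj => by
      rw [Finset.mem_coe, Finsupp.support_filter, Finset.mem_filter] at hj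
      exact hj.2) h1.symm
  have h3 := DFunLike.congr_fun h2 i
  rwa [Finsupp.filter_apply_pos (fun j => deg j = deg i) _ rfl] at h3

theorem coe_toAlg_isHomogeneous (c : Fin n → Fin d → Fin n → K)
    (μ : StdMonomial (VeronesePoset n d)) :
    ((StdMonomial.toAlg (veroneseAlgebraGen c) μ : veroneseAlgebra K n d) :
      MvPolynomial (Fin n) K).IsHomogeneous (d * μ.1.length) := by
  rw [coe_toAlg_veroneseAlgebraGen]
  simpa [card_chainCols] using colProd_isHomogeneous (fun k i => c i k) (chainCols μ.1)

variable [NeZero n]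

theorem FlagIndependent.linearIndependent_toAlg (hd : 0 < d) {c : Fin n → Fin d → Fin n → K}
    (h : FlagIndependent 0 n fun k i => c i k) :
    LinearIndependent K (StdMonomial.toAlg (veroneseAlgebraGen c)) := by
  refine LinearIndependent.of_comp (veroneseAlgebra K n d).val.toLinearMap ?_
  refine linearIndependent_of_isHomogeneous (deg := fun μ => μ.1.length)
    (f := fun μ => d * μ.1.length) (coe_toAlg_isHomogeneous c)
    (fun _ _ => Nat.mul_right_inj hd.ne') fun N => ?_
  have h1 := linearIndepOn_colProd n 0 _ (by simp) h fun _ => N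
  have h2 : (fun μ : StdMonomial (VeronesePoset n d) => chainCols μ.1) '' {μ | μ.1.length = N} ⊆
      stdCols n 0 n fun _ => N := by
    rintro _ ⟨μ, rfl, rfl⟩
    exact chainCols_mem_stdCols_zero μ
  refine ((h1.mono h2).comp_of_image (chainCols_injOn N)).congr fun μ _ => ?_
  exact (coe_toAlg_veroneseAlgebraGen c μ).symm

/-- A linear combination of standard monomials of a fixed degree represents every form. -/
theorem exists_linearCombination_toAlg {c : Fin n → Fin d → Fin n → K} {N : ℕ}
    (h : LinearIndepOn K (colProd fun k i => c i k) (stdCols n 0 n fun _ => N))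
    {x : veroneseAlgebra K n d} (hx : x ∈ veroneseAlgebraGrading K n d N) :
    ∃ r ∈ Finsupp.supported K K {μ : StdMonomial (VeronesePoset n d) | μ.1.length = N},
      Finsupp.linearCombination K (StdMonomial.toAlg (veroneseAlgebraGen c)) r = x := by
  rw [← Finsupp.mem_span_image_iff_linearCombination]
  have hx' : x.1 ∈ homogeneousSubmodule (Fin n) K (∑ _k : Fin d, N) := by
    rw [Finset.sum_const, Finset.card_univ, Fintype.card_fin, smul_eq_mul]
    exact hx
  rw [← span_colProd_eq (NeZero.pos n) h] at hx'
  have hsub : colProd (fun k i => c i k) '' stdCols n 0 n (fun _ => N) ⊆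
      (veroneseAlgebra K n d).val.toLinearMap '' (StdMonomial.toAlg (veroneseAlgebraGen c) ''
        {μ : StdMonomial (VeronesePoset n d) | μ.1.length = N}) := by
    rintro _ ⟨e, he, rfl⟩
    obtain ⟨μ, hμ, rfl⟩ := exists_chainCols_eq he
    exact ⟨_, ⟨μ, hμ, rfl⟩, coe_toAlg_veroneseAlgebraGen c μ⟩
  have h2 := Submodule.span_mono hsub hx'
  rw [Submodule.span_image] at h2
  obtain ⟨y, hy, hyx⟩ := h2
  rwa [← show y = x from Subtype.ext hyx]

theorem FlagIndependent.span_toAlg (hd : 0 < d) {c : Fin n → Fin d → Fin n → K}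
    (h : FlagIndependent 0 n fun k i => c i k) :
    Submodule.span K (Set.range (StdMonomial.toAlg (veroneseAlgebraGen c))) = ⊤ := by
  rw [eq_top_iff, ← (isInternal_veroneseAlgebraGrading hd).submodule_iSup_eq_top, iSup_le_iff]
  intro N x hx
  obtain ⟨r, -, rfl⟩ := exists_linearCombination_toAlg
    (linearIndepOn_colProd n 0 _ (by simp) h fun _ => N) hx
  exact Finsupp.mem_span_range_iff_exists_finsupp.2 ⟨r, rfl⟩

theorem chain_head_le {P : Type*} [PartialOrder P] {μ : StdMonomial P} {γ : P}
    (hγ : μ.1.head? = some γ) : ∀ α ∈ μ.1, γ ≤ α := by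
  obtain ⟨l, hl⟩ := μ
  cases l with
  | nil => simp at hγ
  | cons δ l =>
    obtain rfl : δ = γ := by simpa using hγ
    intro α hα
    rcases List.mem_cons.1 hα with rfl | hα
    · exact le_rfl
    · exact (List.pairwise_cons.1 hl).1 α hα

/-- The first factor of a standard monomial that occurs in the expansion of a multiple of `f_α` is
bounded by `α`. -/
theorem FlagIndependent.head_le {c : Fin n → Fin d → Fin n → K}
    (h : FlagIndependent 0 n fun k i => c i k) {N : ℕ} {α : VeronesePoset n d}
    {x : veroneseAlgebra K n d} {r : StdMonomial (VeronesePoset n d) →₀ K}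
    (hr : r ∈ Finsupp.supported K K {μ : StdMonomial (VeronesePoset n d) | μ.1.length = N})
    (hrx : veroneseAlgebraGen c α * x =
      Finsupp.linearCombination K (StdMonomial.toAlg (veroneseAlgebraGen c)) r)
    {μ : StdMonomial (VeronesePoset n d)} (hμ : μ ∈ r.support) {γ : VeronesePoset n d}
    (hγ : μ.1.head? = some γ) : γ ≤ α := by
  classical
  intro k
  by_contra! hk
  have hαk : (α.1 k : ℕ) + 1 ≤ n := (α.1 k).2
  obtain ⟨T, hT0, hT⟩ := h.exists_column k (α.1 k + 1) (n - (α.1 k + 1)) (by omega)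
  let π : veroneseAlgebra K n d →ₗ[K] MvPolynomial (Fin (n - ((α.1 k : ℕ) + 1))) K :=
    (linSubst T).toLinearMap ∘ₗ (veroneseAlgebra K n d).val.toLinearMap
  have hπ : ∀ ν, π (StdMonomial.toAlg (veroneseAlgebraGen c) ν) =
      colProd (fun k i => T (c i k)) (chainCols ν.1) := fun ν => by
    change linSubst T (StdMonomial.toAlg (veroneseAlgebraGen c) ν : veroneseAlgebra K n d).1 = _
    rw [coe_toAlg_veroneseAlgebraGen, linSubst_colProd]
  -- the standard monomials that survive under `π`
  let S : Set (StdMonomial (VeronesePoset n d)) :=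
    {ν | ν.1.length = N ∧ ∀ β ∈ ν.1, α.1 k < β.1 k}
  have hne : μ.1 ≠ [] := by rintro h0; simp [h0] at hγ
  have hμN : μ.1.length = N := hr hμ
  have hN : N ≠ 0 := by rw [← hμN]; simpa using hne
  have hμS : μ ∈ S := ⟨hμN, fun β hβ => hk.trans_le (chain_head_le hγ β hβ k)⟩
  have hind : LinearIndepOn K (π ∘ StdMonomial.toAlg (veroneseAlgebraGen c)) S := by
    have h1 := linearIndepOn_colProd _ _ _ (by simp [hαk]) hT fun _ => N
    have h2 : (fun ν : StdMonomial (VeronesePoset n d) => chainCols ν.1) '' S ⊆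
        stdCols n (Pi.single k ((α.1 k : ℕ) + 1)) (n - ((α.1 k : ℕ) + 1)) fun _ => N := by
      rintro _ ⟨ν, ⟨rfl, hν⟩, rfl⟩
      refine chainCols_mem_stdCols ν (fun h0 => hN (by simp [h0])) (by simp [hαk]) ?_
      intro β hβ l
      by_cases hl : l = k
      · subst hl
        simpa using Nat.succ_le_of_lt (hν β hβ)
      · simp [hl]
    refine ((h1.mono h2).comp_of_image ((chainCols_injOn N).mono fun ν hν => hν.1)).congr
      fun ν _ => ?_
    exact (hπ ν).symm
  have hzero : ∀ ν ∈ r.support, ν ∉ S → π (StdMonomial.toAlg (veroneseAlgebraGen c) ν) = 0 := by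
    intro ν hν hνS
    obtain ⟨β, hβ, hβk⟩ : ∃ β ∈ ν.1, β.1 k ≤ α.1 k := by
      by_contra! hcon
      exact hνS ⟨hr hν, hcon⟩
    rw [hπ]
    exact colProd_eq_zero_of_mem (mem_chainCols.2 ⟨β, hβ, rfl⟩)
      (hT0 _ (Nat.lt_succ_of_le hβk))
  have hα : π (veroneseAlgebraGen c α * x) = 0 := by
    have h1 : linSubst T (veroneseAlgebraGen c α : veroneseAlgebra K n d).1 = 0 := by
      have := hπ ⟨[α], List.pairwise_singleton _ _⟩
      rw [colProd_eq_zero_of_mem (k := k) (mem_chainCols.2 ⟨α, by simp, rfl⟩)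
        (hT0 _ (Nat.lt_succ_self _))] at this
      rwa [show StdMonomial.toAlg (veroneseAlgebraGen c) ⟨[α], List.pairwise_singleton _ _⟩ =
        veroneseAlgebraGen c α by simp [StdMonomial.toAlg]] at this
    change linSubst T ((veroneseAlgebraGen c α : veroneseAlgebra K n d).1 * x.1) = 0
    rw [map_mul, h1, zero_mul]
  rw [hrx, Finsupp.linearCombination_apply, Finsupp.sum, map_sum] at hα
  have h3 : Finsupp.linearCombination K (π ∘ StdMonomial.toAlg (veroneseAlgebraGen c))
      (r.filter (· ∈ S)) = 0 := by
    rw [Finsupp.linearCombination_apply, Finsupp.sum, Finsupp.support_filter, Finset.sum_filter]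
    refine (Finset.sum_congr rfl fun ν hν => ?_).trans hα
    split_ifs with hνS
    · rw [Finsupp.filter_apply_pos _ _ hνS, π.map_smul]; rfl
    · rw [π.map_smul, hzero ν hν hνS, smul_zero]
  have h4 := linearIndepOn_iff.1 hind (r.filter (· ∈ S)) (fun ν hν => by
    rw [Finset.mem_coe, Finsupp.support_filter, Finset.mem_filter] at hν
    exact hν.2) h3
  have h5 := DFunLike.congr_fun h4 μ
  rw [Finsupp.filter_apply_pos _ _ hμS] at h5
  exact Finsupp.mem_support_iff.1 hμ h5

theorem FlagIndependent.isHomogeneousASL (hd : 0 < d) {c : Fin n → Fin d → Fin n → K}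
    (h : FlagIndependent 0 n fun k i => c i k) :
    IsHomogeneousASL K (veroneseAlgebraGrading K n d) (veroneseAlgebraGen c) where
  finite := inferInstance
  injective := by
    intro α β hαβ
    have := h.linearIndependent_toAlg hd |>.injective
      (a₁ := ⟨[α], List.pairwise_singleton _ _⟩) (a₂ := ⟨[β], List.pairwise_singleton _ _⟩)
      (by simpa [StdMonomial.toAlg] using hαβ)
    simpa using this
  gradedMonoid := inferInstance
  isInternal := isInternal_veroneseAlgebraGrading hd
  degree_zero := veroneseAlgebraGrading_zero
  pos_degree α := ⟨1, one_pos, veroneseAlgebraGen_mem c α⟩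
  generates := by
    have h1 : (⊤ : Submodule K (veroneseAlgebra K n d)) ≤
        Subalgebra.toSubmodule (Algebra.adjoin K (Set.range (veroneseAlgebraGen c))) := by
      rw [← h.span_toAlg hd, Submodule.span_le]
      rintro _ ⟨μ, rfl⟩
      refine Subalgebra.list_prod_mem _ fun y hy => ?_
      obtain ⟨α, -, rfl⟩ := List.mem_map.1 hy
      exact Algebra.subset_adjoin ⟨α, rfl⟩
    exact eq_top_iff.2 fun x _ => h1 (Submodule.mem_top (x := x))
  linearIndependent := h.linearIndependent_toAlg hd
  span_eq_top := h.span_toAlg hd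
  straightening α β hαβ hβα r hr μ hμ := by
    have hdeg : veroneseAlgebraGen c α * veroneseAlgebraGen c β ∈
        veroneseAlgebraGrading K n d (1 + 1) :=
      SetLike.mul_mem_graded (veroneseAlgebraGen_mem c α) (veroneseAlgebraGen_mem c β)
    obtain ⟨r', hr', hrr'⟩ := exists_linearCombination_toAlg
      (linearIndepOn_colProd n 0 _ (by simp) h fun _ => 1 + 1) hdeg
    obtain rfl : r' = r := h.linearIndependent_toAlg hd (hrr'.trans hr)
    obtain ⟨γ, hγ⟩ : ∃ γ, μ.1.head? = some γ := by
      have h2 : μ.1.length = 1 + 1 := hr' hμ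
      cases hl : μ.1 with
      | nil => simp [hl] at h2
      | cons γ l => exact ⟨γ, rfl⟩
    have h1 := h.head_le hr' hr hμ hγ
    have h2 := h.head_le hr' ((mul_comm _ _).trans hr) hμ hγ
    refine ⟨γ, hγ, lt_of_le_of_ne h1 ?_, lt_of_le_of_ne h2 ?_⟩
    · rintro rfl; exact hαβ h2
    · rintro rfl; exact hβα h1
  degree_one := veroneseAlgebraGen_mem c

end VeroneseASL

/-! ### The Veronese modules as modules with straightening laws -/

section VeroneseMSL

variable {K : Type*} [Field K] {n d j : ℕ}

@[to_additive]
theorem prod_dite_lt {M : Type*} [CommMonoid M] (hj : j ≤ d) (f : Fin j → M) (g : Fin d → M) :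
    ∏ k : Fin d, (if h : (k : ℕ) < j then f ⟨k, h⟩ else g k) =
      (∏ k, f k) * ∏ k : Fin d, if (k : ℕ) < j then 1 else g k := by
  obtain ⟨e, rfl⟩ := Nat.exists_eq_add_of_le hj
  simp [Fin.prod_univ_add]

variable [NeZero n]

theorem sum_padOne (hj : j ≤ d) (s : Fin j → Fin n) :
    ∑ k, (padOne d s k : ℕ) = ∑ k, (s k : ℕ) := by
  have : ∀ k, (padOne d s k : ℕ) = if h : (k : ℕ) < j then (s ⟨k, h⟩ : ℕ) else 0 := by
    intro k
    unfold padOne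
    split_ifs <;> simp
  simp_rw [this]
  rw [sum_dite_lt hj (fun k => (s k : ℕ)) fun _ => 0]
  simp

/-- The element `(i₁, ..., i_j, 1, ..., 1)` of `H_n(d)`. -/
def VeronesePoset.pad (hj : j ≤ d) (x : VeronesePoset n j) : VeronesePoset n d :=
  ⟨padOne d x.1, by
    have h1 := sum_padOne hj x.1
    have h2 := x.sum_lt
    simp only [Finset.sum_add_distrib, Finset.sum_const, Finset.card_univ, Fintype.card_fin,
      smul_eq_mul, mul_one]
    omega⟩

theorem padOne_castLE (hj : j ≤ d) (s : Fin j → Fin n) (k : Fin j) :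
    padOne d s (Fin.castLE hj k) = s k := by
  simp [padOne]

theorem VeronesePoset.pad_le_pad {hj : j ≤ d} {x y : VeronesePoset n j} :
    x.pad hj ≤ y.pad hj ↔ x ≤ y := by
  constructor
  · intro h k
    have := h (Fin.castLE hj k)
    simpa only [VeronesePoset.pad, padOne_castLE] using this
  · intro h k
    simp only [VeronesePoset.pad, padOne]
    split_ifs
    · exact h _
    · exact le_rfl

theorem VeronesePoset.pad_injective (hj : j ≤ d) :
    Function.Injective (VeronesePoset.pad hj : VeronesePoset n j → VeronesePoset n d) :=
  fun _ _ h => le_antisymm (pad_le_pad.1 h.le) (pad_le_pad.1 h.ge)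

theorem VeronesePoset.exists_eq_pad (hj : j ≤ d) {γ : VeronesePoset n d}
    (h : ∀ k : Fin d, ¬ (k : ℕ) < j → γ.1 k = 0) : ∃ y : VeronesePoset n j, γ = y.pad hj := by
  have hγ : γ.1 = padOne d fun k => γ.1 (Fin.castLE hj k) := by
    funext k
    unfold padOne
    split_ifs with hk
    · rfl
    · exact h k hk
  refine ⟨⟨fun k => γ.1 (Fin.castLE hj k), ?_⟩, Subtype.ext hγ⟩
  have h1 := sum_padOne hj fun k => γ.1 (Fin.castLE hj k)
  rw [← hγ] at h1
  have h2 := γ.sum_lt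
  simp only [Finset.sum_add_distrib, Finset.sum_const, Finset.card_univ, Fintype.card_fin,
    smul_eq_mul, mul_one]
  omega

theorem VeronesePoset.exists_eq_pad_of_le {hj : j ≤ d} {γ : VeronesePoset n d}
    {x : VeronesePoset n j} (h : γ ≤ x.pad hj) : ∃ y : VeronesePoset n j, γ = y.pad hj := by
  refine exists_eq_pad hj fun k hk => ?_
  have : γ.1 k ≤ padOne d x.1 k := h k
  rw [padOne, dif_neg hk] at this
  exact le_antisymm this (Fin.zero_le _)

/-- One entry `1` in each of the columns `j + 1, ..., d`. -/
def padCols (n d j : ℕ) [NeZero n] : Fin d → Multiset (Fin n) :=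
  fun k => if (k : ℕ) < j then 0 else {0}

theorem coe_veroneseAlgebraGen_pad (hj : j ≤ d) (c : Fin n → Fin d → Fin n → K)
    (x : VeronesePoset n j) :
    (veroneseAlgebraGen c (x.pad hj)).1 =
      colProd (fun k i => c i k) (padCols n d j) * (veroneseModuleGen hj c x).1 := by
  have h1 : ∀ k : Fin d, linForm c (padOne d x.1 k) k =
      if h : (k : ℕ) < j then linForm c (x.1 ⟨k, h⟩) (Fin.castLE hj ⟨k, h⟩) else linForm c 0 k := by
    intro k
    unfold padOne
    split_ifs <;> rfl
  have h2 : colProd (fun k i => c i k) (padCols n d j) =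
      ∏ k : Fin d, if (k : ℕ) < j then 1 else linForm c 0 k := by
    refine Finset.prod_congr rfl fun k _ => ?_
    unfold padCols
    split_ifs
    · simp
    · simp [linForm, linPoly_apply]
  rw [h2, mul_comm]
  change ∏ k, linForm c (padOne d x.1 k) k = _
  rw [Finset.prod_congr rfl fun k _ => h1 k]
  exact prod_dite_lt hj (fun k => linForm c (x.1 k) (Fin.castLE hj k)) fun k => linForm c 0 k

/-- The standard monomial on `H_n(d)` that corresponds to a standard element on `H_n(j)`. -/
def StdElement.toStdMonomial (hj : j ≤ d)
    (e : StdElement (P := VeronesePoset n d) (veroneseIdeal d : VeronesePoset n j → Set _)) :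
    StdMonomial (VeronesePoset n d) :=
  ⟨e.1.pad hj :: e.2.1.1, List.pairwise_cons.2 ⟨fun α hα => by
    obtain ⟨x, ⟨μ, h⟩⟩ := e
    cases hμ : μ.1.head? with
    | none => simp_all
    | some γ => exact (not_not.1 (h γ hμ) : padOne d x.1 ≤ γ.1).trans (chain_head_le hμ α hα),
    e.2.1.2⟩⟩

theorem StdElement.toStdMonomial_injective (hj : j ≤ d) :
    Function.Injective (StdElement.toStdMonomial hj : StdElement (P := VeronesePoset n d)
      (veroneseIdeal d : VeronesePoset n j → Set _) → _) := by
  rintro ⟨x, ⟨μ, h⟩⟩ ⟨y, ⟨ν, h'⟩⟩ hxy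
  have hxy := congrArg Subtype.val hxy
  obtain ⟨h1, h2⟩ := List.cons.inj hxy
  obtain rfl := VeronesePoset.pad_injective hj h1
  obtain rfl : μ = ν := Subtype.ext h2
  rfl

theorem coe_toAlg_toStdMonomial (hj : j ≤ d) (c : Fin n → Fin d → Fin n → K)
    (e : StdElement (P := VeronesePoset n d) (veroneseIdeal d : VeronesePoset n j → Set _)) :
    (StdMonomial.toAlg (veroneseAlgebraGen c) (e.toStdMonomial hj) : veroneseAlgebra K n d).1 =
      colProd (fun k i => c i k) (padCols n d j) *
        (StdElement.toMod (veroneseAlgebraGen c) (veroneseModuleGen hj c) e).1 := by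
  have h1 : StdMonomial.toAlg (veroneseAlgebraGen c) (e.toStdMonomial hj) =
      veroneseAlgebraGen c (e.1.pad hj) * StdMonomial.toAlg (veroneseAlgebraGen c) e.2.1 := by
    simp [StdMonomial.toAlg, StdElement.toStdMonomial]
  have h2 : (StdElement.toMod (veroneseAlgebraGen c) (veroneseModuleGen hj c) e).1 =
      (StdMonomial.toAlg (veroneseAlgebraGen c) e.2.1 : veroneseAlgebra K n d).1 *
        (veroneseModuleGen hj c e.1).1 := rfl
  rw [h1, h2, Subalgebra.coe_mul, coe_veroneseAlgebraGen_pad]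
  ring

/-- Multiplication by `ℓ_{1,j+1} ⋯ ℓ_{1,d}` as a map from `M_j^{(d)}` to `R`. -/
def padMul (c : Fin n → Fin d → Fin n → K) (j : ℕ) :
    veroneseModule K n d j →ₗ[K] MvPolynomial (Fin n) K :=
  LinearMap.mulLeft K (colProd (fun k i => c i k) (padCols n d j)) ∘ₗ
    (veroneseModule K n d j).subtype.restrictScalars K

theorem padMul_apply (c : Fin n → Fin d → Fin n → K) (x : veroneseModule K n d j) :
    padMul c j x = colProd (fun k i => c i k) (padCols n d j) * x.1 := rfl

variable {c : Fin n → Fin d → Fin n → K}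

theorem linearIndependent_padMul_toMod (hj : j ≤ d)
    (h : LinearIndependent K (StdMonomial.toAlg (veroneseAlgebraGen c))) :
    LinearIndependent K fun e : StdElement (P := VeronesePoset n d)
      (veroneseIdeal d : VeronesePoset n j → Set _) =>
      padMul c j (StdElement.toMod (veroneseAlgebraGen c) (veroneseModuleGen hj c) e) := by
  have h1 := (h.comp _ (StdElement.toStdMonomial_injective (j := j) hj)).map'
    (veroneseAlgebra K n d).val.toLinearMap (LinearMap.ker_eq_bot.2 Subtype.val_injective)
  have h2 : (fun e : StdElement (P := VeronesePoset n d)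
      (veroneseIdeal d : VeronesePoset n j → Set _) =>
      padMul c j (StdElement.toMod (veroneseAlgebraGen c) (veroneseModuleGen hj c) e)) =
      fun e => (StdMonomial.toAlg (veroneseAlgebraGen c) (e.toStdMonomial hj) :
        veroneseAlgebra K n d).1 :=
    funext fun e => (coe_toAlg_toStdMonomial hj c e).symm
  rw [h2]
  exact h1

theorem colProd_padCols_ne_zero (hj : j ≤ d)
    (h : LinearIndependent K (StdMonomial.toAlg (veroneseAlgebraGen c))) :
    colProd (fun k i => c i k) (padCols n d j) ≠ 0 := by
  intro h0
  have hn := NeZero.pos n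
  let e : StdElement (P := VeronesePoset n d) (veroneseIdeal d : VeronesePoset n j → Set _) :=
    ⟨⟨fun _ => 0, by simp; omega⟩, ⟨⟨[], List.Pairwise.nil⟩, by simp⟩⟩
  refine (linearIndependent_padMul_toMod hj h).ne_zero e ?_
  rw [padMul_apply, h0, zero_mul]

/-- If the standard monomials are linearly independent, then so are the products of linear forms
over the families of columns of a fixed shape. -/
theorem linearIndepOn_colProd_of_toAlg
    (h : LinearIndependent K (StdMonomial.toAlg (veroneseAlgebraGen c))) (N : ℕ) :
    LinearIndepOn K (colProd fun k i => c i k) (stdCols n 0 n fun _ : Fin d => N) := by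
  have h1 := h.map' (veroneseAlgebra K n d).val.toLinearMap
    (LinearMap.ker_eq_bot.2 Subtype.val_injective)
  have h2 : stdCols n 0 n (fun _ : Fin d => N) ⊆
      (fun μ : StdMonomial (VeronesePoset n d) => chainCols μ.1) '' Set.univ := by
    intro e he
    obtain ⟨μ, -, rfl⟩ := exists_chainCols_eq he
    exact ⟨μ, trivial, rfl⟩
  refine LinearIndepOn.mono (LinearIndepOn.image_of_comp _ _ ?_) h2
  rw [linearIndepOn_univ_iff]
  have h3 : (colProd fun k i => c i k) ∘ (fun μ : StdMonomial (VeronesePoset n d) =>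
      chainCols μ.1) = (veroneseAlgebra K n d).val.toLinearMap ∘
        StdMonomial.toAlg (veroneseAlgebraGen c) :=
    funext fun μ => (coe_toAlg_veroneseAlgebraGen c μ).symm
  rw [h3]
  exact h1

/-- The column lengths of the standard elements of degree `i` of `M_j^{(d)}`. -/
def moduleShape (d j i : ℕ) : Fin d → ℕ := fun k => if (k : ℕ) < j then i + 1 else i

theorem sum_moduleShape (hj : j ≤ d) (i : ℕ) : ∑ k, moduleShape d j i k = d * i + j := by
  have h1 : ∀ k : Fin d, moduleShape d j i k = i + if h : (k : ℕ) < j then 1 else 0 := by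
    intro k
    unfold moduleShape
    split_ifs <;> rfl
  simp_rw [h1, Finset.sum_add_distrib]
  rw [sum_dite_lt hj (fun _ => 1) fun _ => 0]
  simp

theorem add_padCols_mem_stdCols {i : ℕ} {e : Fin d → Multiset (Fin n)}
    (he : e ∈ stdCols n 0 n (moduleShape d j i)) :
    e + padCols n d j ∈ stdCols n 0 n fun _ => i + 1 := by
  obtain ⟨hc, b, hb, hbe⟩ := he
  refine ⟨fun k => ?_, b, hb, fun k l hl => ?_⟩
  · rw [Pi.add_apply, Multiset.card_add, hc, moduleShape, padCols]
    split_ifs <;> simp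
  · rcases Multiset.mem_add.1 hl with hl | hl
    · exact hbe k l hl
    · unfold padCols at hl
      split_ifs at hl
      · simp at hl
      · rw [Multiset.mem_singleton] at hl
        simp [hl]

theorem linearIndepOn_colProd_moduleShape
    (h : LinearIndependent K (StdMonomial.toAlg (veroneseAlgebraGen c))) (i : ℕ) :
    LinearIndepOn K (colProd fun k i => c i k) (stdCols n 0 n (moduleShape d j i)) := by
  have h1 : (fun e => e + padCols n d j) '' stdCols n 0 n (moduleShape d j i) ⊆
      stdCols n 0 n fun _ => i + 1 := by
    rintro _ ⟨e, he, rfl⟩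
    exact add_padCols_mem_stdCols he
  have h2 := ((linearIndepOn_colProd_of_toAlg h (i + 1)).mono h1).comp_of_image
    (add_left_injective _).injOn
  refine LinearIndepOn.of_comp
    (LinearMap.mulRight K (colProd (fun k i => c i k) (padCols n d j))) (h2.congr fun e _ => ?_)
  exact colProd_add _ _ _

theorem exists_toMod_eq_colProd (hj : j ≤ d)
    (h : LinearIndependent K (StdMonomial.toAlg (veroneseAlgebraGen c))) {i : ℕ}
    {e : Fin d → Multiset (Fin n)} (he : e ∈ stdCols n 0 n (moduleShape d j i)) :
    ∃ f : StdElement (P := VeronesePoset n d) (veroneseIdeal d : VeronesePoset n j → Set _),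
      (StdElement.toMod (veroneseAlgebraGen c) (veroneseModuleGen hj c) f).1 =
        colProd (fun k i => c i k) e := by
  obtain ⟨⟨l, hl⟩, hlen, hle⟩ := exists_chainCols_eq (add_padCols_mem_stdCols he)
  cases l with
  | nil => simp at hlen
  | cons γ l =>
    have hγ : ∃ x : VeronesePoset n j, γ = x.pad hj := by
      refine VeronesePoset.exists_eq_pad hj fun k hk => ?_
      have h0 : (0 : Fin n) ∈ chainCols (γ :: l) k := by
        rw [hle, Pi.add_apply, Multiset.mem_add, padCols, if_neg hk]
        simp
      obtain ⟨α, hα, hα0⟩ := mem_chainCols.1 h0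
      have : γ.1 k ≤ α.1 k := chain_head_le (μ := ⟨γ :: l, hl⟩) rfl α hα k
      rw [hα0] at this
      exact le_antisymm this (Fin.zero_le _)
    obtain ⟨x, rfl⟩ := hγ
    obtain ⟨h1, h2⟩ := List.pairwise_cons.1 hl
    let f : StdElement (P := VeronesePoset n d) (veroneseIdeal d : VeronesePoset n j → Set _) :=
      ⟨x, ⟨⟨l, h2⟩, fun α hα => not_not.2 (h1 α (List.mem_of_mem_head? hα))⟩⟩
    refine ⟨f, mul_left_cancel₀ (colProd_padCols_ne_zero hj h) ?_⟩
    rw [← coe_toAlg_toStdMonomial, coe_toAlg_veroneseAlgebraGen, ← colProd_add,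
      add_comm (padCols n d j), ← hle]
    rfl

theorem span_toMod_eq_top (hd : 0 < d) (hj : j ≤ d)
    (h : LinearIndependent K (StdMonomial.toAlg (veroneseAlgebraGen c))) :
    Submodule.span K (Set.range (StdElement.toMod (veroneseAlgebraGen c) (veroneseModuleGen hj c)
      (I := veroneseIdeal d))) = ⊤ := by
  rw [eq_top_iff, ← (isInternal_veroneseModuleGrading hd j).submodule_iSup_eq_top, iSup_le_iff]
  intro i x hx
  have hx' : x.1 ∈ homogeneousSubmodule (Fin n) K (∑ k, moduleShape d j i k) := by
    rw [sum_moduleShape hj]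
    exact hx
  rw [← span_colProd_eq (NeZero.pos n) (linearIndepOn_colProd_moduleShape h i)] at hx'
  have hsub : colProd (fun k i => c i k) '' stdCols n 0 n (moduleShape d j i) ⊆
      (veroneseModule K n d j).subtype.restrictScalars K '' Set.range
        (StdElement.toMod (veroneseAlgebraGen c) (veroneseModuleGen hj c)
          (I := veroneseIdeal d)) := by
    rintro _ ⟨e, he, rfl⟩
    obtain ⟨f, hf⟩ := exists_toMod_eq_colProd hj h he
    exact ⟨_, ⟨f, rfl⟩, hf⟩
  have h2 := Submodule.span_mono hsub hx'
  rw [Submodule.span_image] at h2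
  obtain ⟨y, hy, hyx⟩ := h2
  rwa [← show y = x from Subtype.ext hyx]

theorem smul_veroneseModuleGen_mem_span (hj : j ≤ d)
    (h : IsHomogeneousASL K (veroneseAlgebraGrading K n d) (veroneseAlgebraGen c))
    (x : VeronesePoset n j) (α : VeronesePoset n d) (hα : α ∈ veroneseIdeal d x) :
    veroneseAlgebraGen c α • veroneseModuleGen hj c x ∈
      Submodule.span (veroneseAlgebra K n d) (veroneseModuleGen hj c '' {y | y < x}) := by
  set S := Submodule.span (veroneseAlgebra K n d) (veroneseModuleGen hj c '' {y | y < x}) with hS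
  have hmem : ∀ (a : veroneseAlgebra K n d) (y : VeronesePoset n j), y < x →
      a • veroneseModuleGen hj c y ∈ S :=
    fun a y hy => S.smul_mem a (Submodule.subset_span ⟨y, hy, rfl⟩)
  have hp := colProd_padCols_ne_zero hj h.linearIndependent
  by_cases hle : α ≤ x.pad hj
  · obtain ⟨y, rfl⟩ := VeronesePoset.exists_eq_pad_of_le hle
    have hyx : y < x := lt_of_le_of_ne (VeronesePoset.pad_le_pad.1 hle) (by
      rintro rfl; exact hα le_rfl)
    convert hmem (veroneseAlgebraGen c (x.pad hj)) y hyx using 1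
    refine Subtype.ext ?_
    change (veroneseAlgebraGen c (y.pad hj)).1 * (veroneseModuleGen hj c x).1 =
      (veroneseAlgebraGen c (x.pad hj)).1 * (veroneseModuleGen hj c y).1
    rw [coe_veroneseAlgebraGen_pad, coe_veroneseAlgebraGen_pad]
    ring
  · obtain ⟨r, hr⟩ := Finsupp.mem_span_range_iff_exists_finsupp.1
      (h.span_eq_top ▸ Submodule.mem_top :
        veroneseAlgebraGen c α * veroneseAlgebraGen c (x.pad hj) ∈
          Submodule.span K (Set.range (StdMonomial.toAlg (veroneseAlgebraGen c))))
    have hst := h.straightening α (x.pad hj) hle hα r hr.symm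
    have hz : ∀ μ ∈ r.support, ∃ z ∈ S, colProd (fun k i => c i k) (padCols n d j) * z.1 =
        (r μ • StdMonomial.toAlg (veroneseAlgebraGen c) μ : veroneseAlgebra K n d).1 := by
      intro μ hμ
      obtain ⟨γ, hγ, -, hγx⟩ := hst μ hμ
      obtain ⟨y, rfl⟩ := VeronesePoset.exists_eq_pad_of_le hγx.le
      have hyx : y < x := lt_of_le_of_ne (VeronesePoset.pad_le_pad.1 hγx.le) (by
        rintro rfl; exact lt_irrefl _ hγx)
      obtain ⟨l, hl⟩ : ∃ l, μ.1 = y.pad hj :: l := by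
        obtain ⟨l, hl⟩ := List.head?_eq_some_iff.1 hγ
        exact ⟨l, hl⟩
      refine ⟨_, hmem (r μ • (l.map (veroneseAlgebraGen c)).prod) y hyx, ?_⟩
      have h1 : StdMonomial.toAlg (veroneseAlgebraGen c) μ =
          veroneseAlgebraGen c (y.pad hj) * (l.map (veroneseAlgebraGen c)).prod := by
        simp [StdMonomial.toAlg, hl]
      rw [h1]
      change _ * ((r μ • (l.map (veroneseAlgebraGen c)).prod.1) * (veroneseModuleGen hj c y).1) =
        r μ • ((veroneseAlgebraGen c (y.pad hj)).1 * (l.map (veroneseAlgebraGen c)).prod.1)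
      rw [coe_veroneseAlgebraGen_pad, smul_mul_assoc, mul_smul_comm]
      congr 1
      ring
    choose! z hzS hz using hz
    convert S.sum_mem (t := r.support) (f := z) hzS using 1
    refine Subtype.ext (mul_left_cancel₀ hp ?_)
    rw [AddSubmonoidClass.coe_finsetSum, Finset.mul_sum, Finset.sum_congr rfl hz,
      ← AddSubmonoidClass.coe_finsetSum]
    change colProd (fun k i => c i k) (padCols n d j) * ((veroneseAlgebraGen c α).1 *
      (veroneseModuleGen hj c x).1) = (r.sum fun μ a => a • StdMonomial.toAlg (veroneseAlgebraGen c) μ).1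
    rw [hr, Subalgebra.coe_mul, coe_veroneseAlgebraGen_pad]
    ring

theorem isHomogeneousMSL_of_isHomogeneousASL (hd : 0 < d) (hj : j ≤ d)
    (h : IsHomogeneousASL K (veroneseAlgebraGrading K n d) (veroneseAlgebraGen c)) :
    IsHomogeneousMSL K (veroneseAlgebraGrading K n d) (veroneseModuleGrading K n d j)
      (veroneseAlgebraGen c) (veroneseModuleGen hj c) (veroneseIdeal d) := by
  have hind : LinearIndependent K (StdElement.toMod (veroneseAlgebraGen c)
      (veroneseModuleGen hj c) (I := veroneseIdeal d)) :=
    LinearIndependent.of_comp (padMul c j) (linearIndependent_padMul_toMod hj h.linearIndependent)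
  exact
  { isASL := h.toIsGradedASL
    finite := inferInstance
    injective := by
      intro x y hxy
      have h1 : (⟨x, ⟨⟨[], List.Pairwise.nil⟩, by simp⟩⟩ : StdElement (P := VeronesePoset n d)
          (veroneseIdeal d : VeronesePoset n j → Set _)) =
          ⟨y, ⟨⟨[], List.Pairwise.nil⟩, by simp⟩⟩ :=
        hind.injective (by simp only [StdElement.toMod, hxy])
      exact congrArg Sigma.fst h1
    isPosetIdeal := fun x α β hβα hα hβ => hα (le_trans hβ hβα)
    linearIndependent := hind
    span_eq_top := span_toMod_eq_top hd hj h.linearIndependent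
    straightening := smul_veroneseModuleGen_mem_span hj h
    isHomogeneousASL := h
    gradedSMul := gradedSMul_veroneseModuleGrading j
    isInternal := isInternal_veroneseModuleGrading hd j
    degree_zero := veroneseModuleGen_mem hj c }

end VeroneseMSL

/-! ### Generic linear forms -/

section Generic

variable {K : Type*} [Field K] {n d : ℕ}

/-- The product of all maximal minors of the generic coefficient matrix. -/
def minorProduct (K : Type*) [Field K] (n d : ℕ) : MvPolynomial (Fin n × Fin d × Fin n) K :=
  open Classical in
  ∏ g : Fin n ↪ Fin n × Fin d,
    Matrix.det (Matrix.of fun r s : Fin n => X (R := K) ((g r).1, (g r).2, s))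

theorem eval_det_generic (c : Fin n → Fin d → Fin n → K) (g : Fin n → Fin n × Fin d) :
    eval (fun t => c t.1 t.2.1 t.2.2)
      (Matrix.det (Matrix.of fun r s : Fin n => X (R := K) ((g r).1, (g r).2, s))) =
    Matrix.det (Matrix.of fun r s : Fin n => c (g r).1 (g r).2 s) := by
  rw [RingHom.map_det]
  congr 1
  ext r s
  simp

theorem minorProduct_ne_zero [Infinite K] : minorProduct K n d ≠ 0 := by
  classical
  refine Finset.prod_ne_zero_iff.2 fun g _ h0 => ?_
  let τ : Fin n × Fin d ↪ K := (Function.Embedding.trans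
    (Finite.equivFin (Fin n × Fin d)).toEmbedding (Fin.valEmbedding.trans (Infinite.natEmbedding K)))
  have h1 := eval_det_generic (fun i k s => τ (i, k) ^ (s : ℕ)) g
  rw [h0, map_zero] at h1
  have h2 : (Matrix.vandermonde fun r => τ (g r)).det ≠ 0 :=
    Matrix.det_vandermonde_ne_zero_iff.2 (τ.injective.comp g.injective)
  exact h2 h1.symm

theorem linearIndependent_of_eval_minorProduct {c : Fin n → Fin d → Fin n → K}
    (h : eval (fun t => c t.1 t.2.1 t.2.2) (minorProduct K n d) ≠ 0)
    (g : Fin n ↪ Fin n × Fin d) : LinearIndependent K fun r => c (g r).1 (g r).2 := by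
  classical
  rw [minorProduct, map_prod, Finset.prod_ne_zero_iff] at h
  have h1 := h g (Finset.mem_univ g)
  rw [eval_det_generic] at h1
  exact Matrix.linearIndependent_rows_of_det_ne_zero h1

theorem transversalsIndependent_of_eval_minorProduct {c : Fin n → Fin d → Fin n → K}
    (h : eval (fun t => c t.1 t.2.1 t.2.2) (minorProduct K n d) ≠ 0) :
    TransversalsIndependent c := by
  intro σ
  have h1 := linearIndependent_of_eval_minorProduct h
    ⟨fun i => (i, σ i), fun i j hij => congrArg Prod.fst hij⟩
  exact h1.map' (linPoly K n) (LinearMap.ker_eq_bot.2 linPoly_injective)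

theorem flagIndependent_of_eval_minorProduct (hd : 0 < d) {c : Fin n → Fin d → Fin n → K}
    (h : eval (fun t => c t.1 t.2.1 t.2.2) (minorProduct K n d) ≠ 0) :
    FlagIndependent 0 n fun k i => c i k := by
  classical
  intro b hb
  let S : Finset (Fin d × Fin n) := Finset.univ.filter fun q => (q.2 : ℕ) < b q.1
  have hS : S.card ≤ n := by
    refine le_trans ?_ hb
    rw [Finset.card_eq_sum_card_fiberwise (f := Prod.fst) (t := Finset.univ) (by simp)]
    refine Finset.sum_le_sum fun k _ => ?_
    have : (S.filter fun q => q.1 = k).card ≤ (Finset.range (b k)).card := by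
      refine Finset.card_le_card_of_injOn (fun q => (q.2 : ℕ)) ?_ ?_
      · intro q hq
        simp [S] at hq ⊢
        rw [← hq.2]; exact hq.1
      · intro q hq q' hq' hqq
        simp at hq hq'
        exact Prod.ext (hq.2.trans hq'.2.symm) (Fin.ext hqq)
    simpa using this
  obtain ⟨S', hSS', hcard⟩ := Finset.exists_superset_card_eq hS
    (by simpa using Nat.le_mul_of_pos_left n hd)
  let e : Fin n ≃ S' := (Finset.equivFinOfCardEq hcard).symm
  have h1 := linearIndependent_of_eval_minorProduct h
    ⟨fun r => ((e r).1.2, (e r).1.1), fun r r' hrr => e.injective (Subtype.ext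
      (Prod.ext (congrArg Prod.snd hrr) (congrArg Prod.fst hrr)))⟩
  have h2 : LinearIndepOn K (fun q : Fin d × Fin n => c q.2 q.1) (S' : Set (Fin d × Fin n)) := by
    have : LinearIndependent K fun x : S' => c (e (e.symm x)).1.2 (e (e.symm x)).1.1 :=
      h1.comp e.symm e.symm.injective
    simp only [Equiv.apply_symm_apply] at this
    exact this
  refine h2.mono fun q hq => hSS' ?_
  simpa [S] using hq

end Generic

end

theorem mainTheorem1 (K : Type*) [Field K] [Infinite K] (n d : ℕ) [NeZero n] (hd : 2 ≤ d) :
    HoldsGenerically K n d (fun c =>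
      TransversalsIndependent c ∧
      IsHomogeneousASL K (veroneseAlgebraGrading K n d) (veroneseAlgebraGen c) ∧
      ∀ (j : ℕ) (hj : j < d),
        IsHomogeneousMSL K (veroneseAlgebraGrading K n d) (veroneseModuleGrading K n d j)
          (veroneseAlgebraGen c) (veroneseModuleGen hj.le c) (veroneseIdeal d)) ∧
    ∀ c : Fin n → Fin d → Fin n → K,
      IsHomogeneousASL K (veroneseAlgebraGrading K n d) (veroneseAlgebraGen c) →
      ∀ (j : ℕ) (hj : j < d),
        IsHomogeneousMSL K (veroneseAlgebraGrading K n d) (veroneseModuleGrading K n d j)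
          (veroneseAlgebraGen c) (veroneseModuleGen hj.le c) (veroneseIdeal d) := by
  have hd0 : 0 < d := by omega
  refine ⟨⟨minorProduct K n d, minorProduct_ne_zero, fun c hc => ?_⟩,
    fun c h j hj => isHomogeneousMSL_of_isHomogeneousASL hd0 hj.le h⟩
  have h := (flagIndependent_of_eval_minorProduct hd0 hc).isHomogeneousASL hd0
  exact ⟨transversalsIndependent_of_eval_minorProduct hc, h,
    fun j hj => isHomogeneousMSL_of_isHomogeneousASL hd0 hj.le h⟩
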